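/- All systems are finite dimensional. An \emph{entanglement monotone} $E$ is a real function of the states of all bipartite systems that is nonnegative on states, vanishes on separable states, and is nonincreasing under (finite-round) local operations and classical communication. A \emph{correlation monotone} $C$ is a real function of the states of all bipartite systems that is nonnegative on states, vanishes on product states, and is nonincreasing under quantum operations performed on one of the two systems. Let $\mathcal E_d$ be the set of probability vectors with at most $d$ nonzero components, in decreasing order, padded with zeros to length $d$. For a correlation monotone $C$ and $\boldsymbol p\in\mathcal E_d$, let $f(\boldsymbol p)=C(|\psi\rangle\langle\psi|)$ with $|\psi\rangle=\sum_i\sqrt{p_i}\,|i\rangle|i\rangle\in\mathbb C^d\otimes\mathbb C^d$, i.e. the value of $C$ on pure states with Schmidt coefficients $\sqrt{p_i}$, and let $c_d=\sup_{\mathcal E_d} f$. Let $d_2\ge d_1\ge 2$ and $d=d_1d_2$. For an entanglement monotone $E$, let $e_{d_1}$ be the largest value of $E$ on the pure states of $\mathbb C^{d_1}\otimes\mathbb C^{d_2}$, and, for $\boldsymbol p\in\mathcal E_d$ and $x\in[0,c_d]$, $$s_{d_1,d_2}(\boldsymbol p)=e_{d_1}-\sup_{\{|i\rangle\}}E\Big(\sum_i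 p_i|i\rangle\langle i|\Big),\qquad g_d(x)=\inf_{\boldsymbol p\in\mathcal E_d,\ f(\boldsymbol p)=x}s_{d_1,d_2}(\boldsymbol p),\qquad \xi^{(E,C)}_{d_1,d_2}(x)=e_{d_1}-g_d(x),$$ where the supremum is over the orthonormal bases of $\mathbb C^{d_1}\otimes\mathbb C^{d_2}$. \textbf{Claim.} Let $E$ and $E'$ be entanglement monotones which are zero only for separable states, and let $C$ be a correlation monotone such that $f$ is continuous on $\mathcal E_d$. If $J\subseteq[0,c_d]$ is an interval such that $\xi^{(E,C)}_{d_1,d_2}$ vanishes on $J$ and is positive on $[0,c_d]\setminus J$, then $\xi^{(E',C)}_{d_1,d_2}$ also vanishes on $J$ and is positive on $[0,c_d]\setminus J$. Moreover, $\xi^{(E,C)}_{d_1,d_2}$ and $\xi^{(E',C)}_{d_1,d_2}$ have the same set of zeros in $[0,c_d]$. In particular the threshold does not depend on the entanglement monotone: for every real $t$, the conditions that $0\le t<c_d$, $\xi^{(E,C)}_{d_1,d_2}=0$ on $(t,c_d]$ and $\xi^{(E,C)}_{d_1,d_2}>0$ on $[0,t)$ hold if and only if the same conditions hold with $E'$ in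 place of $E$. -/

import Mathlib

open Matrix
open scoped Kronecker ComplexOrder

noncomputable section

namespace QInfo

/-- Operators on the bipartite Hilbert space `ℂ^m ⊗ ℂ^n`. -/
abbrev BiMat (m n : ℕ) : Type := Matrix (Fin m × Fin n) (Fin m × Fin n) ℂ

/-- Density operators: positive semidefinite with unit trace. -/
def IsState {ι : Type} [Fintype ι] (ρ : Matrix ι ι ℂ) : Prop :=
  ρ.PosSemidef ∧ ρ.trace = 1

/-- The rank-one operator `|ψ⟩⟨ψ|`. -/
def ketbra {ι : Type} (ψ : ι → ℂ) : Matrix ι ι ℂ := vecMulVec ψ (star ψ)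

/-- Product states `α ⊗ β`. -/
def IsProduct {m n : ℕ} (ρ : BiMat m n) : Prop :=
  ∃ (α : Matrix (Fin m) (Fin m) ℂ) (β : Matrix (Fin n) (Fin n) ℂ),
    IsState α ∧ IsState β ∧ ρ = α ⊗ₖ β

/-- Separable states: finite mixtures of product states. -/
def IsSeparable {m n : ℕ} (ρ : BiMat m n) : Prop :=
  ∃ (k : ℕ) (w : Fin k → ℝ) (σ : Fin k → BiMat m n),
    (∀ i, 0 ≤ w i) ∧ ∑ i, w i = 1 ∧ (∀ i, IsProduct (σ i)) ∧
      ρ = ∑ i, ((w i : ℝ) : ℂ) • σ i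

/-- A complete family of Kraus operators on `ℂ^m`, the `j`-th one with values in `ℂ^(r j)`:
a quantum measurement with outcomes `j`. -/
def IsKraus {m k : ℕ} (r : Fin k → ℕ) (K : ∀ j, Matrix (Fin (r j)) (Fin m) ℂ) : Prop :=
  ∑ j, (K j)ᴴ * K j = 1

/-- `ρ ↦ (K ⊗ 1) ρ (K ⊗ 1)ᴴ`. -/
def actA {m m' n : ℕ} (K : Matrix (Fin m') (Fin m) ℂ) (ρ : BiMat m n) : BiMat m' n :=
  (K ⊗ₖ (1 : Matrix (Fin n) (Fin n) ℂ)) * ρ * (K ⊗ₖ (1 : Matrix (Fin n) (Fin n) ℂ))ᴴ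

/-- `ρ ↦ (1 ⊗ K) ρ (1 ⊗ K)ᴴ`. -/
def actB {m n n' : ℕ} (K : Matrix (Fin n') (Fin n) ℂ) (ρ : BiMat m n) : BiMat m n' :=
  ((1 : Matrix (Fin m) (Fin m) ℂ) ⊗ₖ K) * ρ * ((1 : Matrix (Fin m) (Fin m) ℂ) ⊗ₖ K)ᴴ

/-- Local operations and classical communication: finite protocols, in each step of which one
of the two parties performs a measurement on its subsystem and announces the outcome `j`, on
which the remaining protocol `Λ j` may depend. At the end the outcomes are forgotten. -/
inductive IsLOCC : {m n m' n' : ℕ} → (BiMat m n → BiMat m' n') → Prop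
  | refl (m n : ℕ) : IsLOCC (fun ρ : BiMat m n => ρ)
  | stepA {m n m' n' k : ℕ} (r : Fin k → ℕ) (K : ∀ j, Matrix (Fin (r j)) (Fin m) ℂ)
      (hK : IsKraus r K) (Λ : ∀ j, BiMat (r j) n → BiMat m' n') (hΛ : ∀ j, IsLOCC (Λ j)) :
      IsLOCC (fun ρ : BiMat m n => ∑ j, Λ j (actA (K j) ρ))
  | stepB {m n m' n' k : ℕ} (r : Fin k → ℕ) (K : ∀ j, Matrix (Fin (r j)) (Fin n) ℂ)
      (hK : IsKraus r K) (Λ : ∀ j, BiMat m (r j) → BiMat m' n') (hΛ : ∀ j, IsLOCC (Λ j)) :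
      IsLOCC (fun ρ : BiMat m n => ∑ j, Λ j (actB (K j) ρ))

/-- Real functions of the states of all finite-dimensional bipartite systems.
Only the values at density operators matter. -/
abbrev BiFun : Type := ∀ m n : ℕ, BiMat m n → ℝ

/-- Entanglement monotones: nonnegative, zero on separable states, nonincreasing under LOCC. -/
structure IsEntanglementMonotone (E : BiFun) : Prop where
  nonneg : ∀ (m n : ℕ) (ρ : BiMat m n), IsState ρ → 0 ≤ E m n ρ
  separable : ∀ (m n : ℕ) (ρ : BiMat m n), IsSeparable ρ → E m n ρ = 0
  locc : ∀ (m n m' n' : ℕ) (Λ : BiMat m n → BiMat m' n'), IsLOCC Λ →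
    ∀ ρ : BiMat m n, IsState ρ → E m' n' (Λ ρ) ≤ E m n ρ

/-- `E` is zero only for separable states. -/
def ZeroOnlyForSeparable (E : BiFun) : Prop :=
  ∀ (m n : ℕ) (ρ : BiMat m n), IsState ρ → E m n ρ = 0 → IsSeparable ρ

/-- Correlation monotones: nonnegative, zero on product states, nonincreasing under quantum
operations performed on one of the two systems. -/
structure IsCorrelationMonotone (C : BiFun) : Prop where
  nonneg : ∀ (m n : ℕ) (ρ : BiMat m n), IsState ρ → 0 ≤ C m n ρ
  product : ∀ (m n : ℕ) (ρ : BiMat m n), IsProduct ρ → C m n ρ = 0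
  localA : ∀ (m n m' k : ℕ) (K : Fin k → Matrix (Fin m') (Fin m) ℂ),
    IsKraus (fun _ => m') K → ∀ ρ : BiMat m n, IsState ρ →
      C m' n (∑ j, actA (K j) ρ) ≤ C m n ρ
  localB : ∀ (m n n' k : ℕ) (K : Fin k → Matrix (Fin n') (Fin n) ℂ),
    IsKraus (fun _ => n') K → ∀ ρ : BiMat m n, IsState ρ →
      C m n' (∑ j, actB (K j) ρ) ≤ C m n ρ

/-- The set `𝓔_d` of probability vectors with at most `d` nonzero components, in decreasing
order, padded with zeros to length `d`. -/
def probVecs (d : ℕ) : Set (Fin d → ℝ) :=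
  {p | Antitone p ∧ (∀ i, 0 ≤ p i) ∧ ∑ i, p i = 1}

/-- The vector `∑ i, √(p i) |i⟩|i⟩` of `ℂ^d ⊗ ℂ^d`, with Schmidt coefficients `√(p i)`. -/
def schmidtVec {d : ℕ} (p : Fin d → ℝ) : Fin d × Fin d → ℂ :=
  fun ij => if ij.1 = ij.2 then ((Real.sqrt (p ij.1) : ℝ) : ℂ) else 0

/-- The function `f` of the probability vectors attached to `C`: the value of `C` at the pure
states with Schmidt coefficients `√(p i)`. -/
def corrFun (C : BiFun) {d : ℕ} (p : Fin d → ℝ) : ℝ := C d d (ketbra (schmidtVec p))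

/-- `c_d`, the supremum of `f` on `𝓔_d`. -/
def corrMax (C : BiFun) (d : ℕ) : ℝ := sSup ((fun p : Fin d → ℝ => corrFun C p) '' probVecs d)

/-- `e_{d₁}`, the largest value of `E` on the pure states of `ℂ^d₁ ⊗ ℂ^d₂`. -/
def entMax (E : BiFun) (d₁ d₂ : ℕ) : ℝ :=
  sSup {y | ∃ ψ : EuclideanSpace ℂ (Fin d₁ × Fin d₂), ‖ψ‖ = 1 ∧ y = E d₁ d₂ (ketbra ψ.ofLp)}

/-- The state `∑ i, p i |b i⟩⟨b i|` for an orthonormal basis `b` of `ℂ^d₁ ⊗ ℂ^d₂`. -/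
def spectralState {d₁ d₂ : ℕ} (p : Fin (d₁ * d₂) → ℝ)
    (b : OrthonormalBasis (Fin (d₁ * d₂)) ℂ (EuclideanSpace ℂ (Fin d₁ × Fin d₂))) :
    BiMat d₁ d₂ :=
  ∑ i, ((p i : ℝ) : ℂ) • ketbra (b i).ofLp

/-- `s_{d₁,d₂}(p)`: `e_{d₁}` minus the supremum of `E` over the states with spectrum `p`. -/
def entEntropy (E : BiFun) (d₁ d₂ : ℕ) (p : Fin (d₁ * d₂) → ℝ) : ℝ :=
  entMax E d₁ d₂ -
    sSup {y | ∃ b : OrthonormalBasis (Fin (d₁ * d₂)) ℂ (EuclideanSpace ℂ (Fin d₁ × Fin d₂)),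
      y = E d₁ d₂ (spectralState p b)}

/-- `g_d(x)`, the infimum of `s_{d₁,d₂}` over the `p ∈ 𝓔_d` with `f(p) = x`, where `d = d₁d₂`. -/
def gFun (E C : BiFun) (d₁ d₂ : ℕ) (x : ℝ) : ℝ :=
  sInf {y | ∃ p ∈ probVecs (d₁ * d₂), corrFun C p = x ∧ y = entEntropy E d₁ d₂ p}

/-- `ξ^{(E,C)}_{d₁,d₂} = e_{d₁} - g_d`, to be used on `[0, c_d]`, where `d = d₁d₂`. -/
def xi (E C : BiFun) (d₁ d₂ : ℕ) (x : ℝ) : ℝ := entMax E d₁ d₂ - gFun E C d₁ d₂ x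

/-- `ξ`, as a function on `[0, c]`, vanishes on `J` and is positive elsewhere. -/
def VanishesExactlyOn (ξ : ℝ → ℝ) (c : ℝ) (J : Set ℝ) : Prop :=
  (∀ x ∈ J, ξ x = 0) ∧ ∀ x ∈ Set.Icc 0 c \ J, 0 < ξ x

/-- `t < c` is a threshold of `ξ` on `[0, c]`: `ξ` is zero above `t` and positive below `t`. -/
def IsThreshold (ξ : ℝ → ℝ) (c t : ℝ) : Prop :=
  0 ≤ t ∧ t < c ∧ (∀ x, t < x → x ≤ c → ξ x = 0) ∧ ∀ x, 0 ≤ x → x < t → 0 < ξ x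

end QInfo

end

open QInfo

/-! Over an attained value `x` of `f`, `ξ(x)` is the supremum of `E` over all states whose spectrum
`p` satisfies `f(p) = x`, because the constant `e_{d₁}` cancels. Since `E ≥ 0` and `E` vanishes
exactly on separable states, `ξ(x) = 0` iff all these states are separable, a condition not
involving `E` (`xi_eq_zero_iff`).

Two facts keep the real `sSup` and `sInf` from taking default values. Boundedness: by teleportation,
LOCC turns the maximally entangled state into any mixture, so its `E`-value bounds all others
(`exists_isLOCC_maxEnt`, `spectralState_le`). Nonempty fibres: `f` attains all of `[0, c_d]` by the
intermediate value theorem (`exists_corrFun_eq`). -/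

namespace QInfo

/-! ### Weyl operators -/

/-- The Weyl operator `|j⟩ ↦ χ(b j) |j + a⟩` on `ℂ^d`, with `d = n + 1`. -/
noncomputable def weyl {n : ℕ} (a b : ZMod (n + 1)) : Matrix (ZMod (n + 1)) (ZMod (n + 1)) ℂ :=
  fun i j => if i = j + a then ZMod.stdAddChar (j * b) else 0

theorem conj_stdAddChar_mul {n : ℕ} (x y : ZMod (n + 1)) :
    star (ZMod.stdAddChar x : ℂ) * ZMod.stdAddChar y = ZMod.stdAddChar (y - x) := by
  rw [sub_eq_add_neg, AddChar.map_add_eq_mul, AddChar.map_neg_eq_conj, mul_comm]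
  rfl

theorem weyl_mul_conjTranspose {n : ℕ} (a b : ZMod (n + 1)) :
    weyl a b * (weyl a b)ᴴ = 1 := by
  ext i k
  rw [Matrix.mul_apply, Finset.sum_eq_single (i - a)]
  · by_cases h : i = k
    · subst h
      simp only [weyl, conjTranspose_apply, sub_add_cancel, if_true, one_apply_eq]
      rw [mul_comm, conj_stdAddChar_mul]
      simp
    · simp [weyl, conjTranspose_apply, Matrix.one_apply_ne h, Ne.symm h]
  · intro j _ hj
    have : i ≠ j + a := fun h => hj (by rw [h]; ring)
    simp [weyl, this]
  · simp

/-- Twirling over the Weyl operators is completely depolarizing. -/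
theorem sum_weyl_conj {n : ℕ} (X : Matrix (ZMod (n + 1)) (ZMod (n + 1)) ℂ) :
    ∑ a, ∑ b, (weyl a b)ᴴ * X * weyl a b = (((n + 1 : ℕ) : ℂ) * X.trace) • 1 := by
  have entry : ∀ a b i k : ZMod (n + 1), ((weyl a b)ᴴ * X * weyl a b) i k =
      X (i + a) (k + a) * ZMod.stdAddChar (b * (k - i)) := by
    intro a b i k
    rw [Matrix.mul_apply, Finset.sum_eq_single (k + a)]
    · rw [Matrix.mul_apply, Finset.sum_eq_single (i + a)]
      · simp only [weyl, conjTranspose_apply, if_true]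
        rw [mul_assoc, mul_left_comm, conj_stdAddChar_mul]
        congr 2
        ring
      · intro j _ hj
        simp [weyl, conjTranspose_apply, hj]
      · simp
    · intro j _ hj
      simp [weyl, hj]
    · simp
  ext i k
  simp only [Matrix.sum_apply, entry, ← Finset.mul_sum, Matrix.smul_apply, smul_eq_mul]
  -- Orthogonality of characters: the sum over `b` kills the off-diagonal entries. On the diagonal,
  -- the sum over the shift `a` gives the trace.
  simp only [AddChar.sum_mulShift (k - i) (ZMod.isPrimitive_stdAddChar (n + 1))]
  by_cases h : i = k
  · subst h
    simp only [sub_self, if_true, one_apply_eq, mul_one, ← Finset.sum_mul, ZMod.card]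
    rw [mul_comm]
    congr 1
    exact Equiv.sum_comp (Equiv.addLeft i) (fun j => X j j)
  · simp [sub_eq_zero, Ne.symm h, Matrix.one_apply_ne h]

/-! ### Teleportation -/

theorem mul_ketbra_mul_conjTranspose {ι κ : Type} [Fintype ι] [Fintype κ]
    (K : Matrix κ ι ℂ) (ψ : ι → ℂ) : K * ketbra ψ * Kᴴ = ketbra (K *ᵥ ψ) := by
  rw [ketbra, ketbra, mul_vecMulVec, vecMulVec_mul, star_mulVec]

theorem actA_ketbra {m m' n : ℕ} (K : Matrix (Fin m') (Fin m) ℂ) (ψ : Fin m × Fin n → ℂ) :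
    actA K (ketbra ψ) = ketbra ((K ⊗ₖ (1 : Matrix (Fin n) (Fin n) ℂ)) *ᵥ ψ) :=
  mul_ketbra_mul_conjTranspose _ _

theorem actB_ketbra {m n n' : ℕ} (K : Matrix (Fin n') (Fin n) ℂ) (ψ : Fin m × Fin n → ℂ) :
    actB K (ketbra ψ) = ketbra (((1 : Matrix (Fin m) (Fin m) ℂ) ⊗ₖ K) *ᵥ ψ) :=
  mul_ketbra_mul_conjTranspose _ _

/-- The vector of `ℂ^m ⊗ ℂ^n` with coefficient matrix `M`. -/
def vecOf {m n : ℕ} (M : Matrix (Fin m) (Fin n) ℂ) : Fin m × Fin n → ℂ := fun ij => M ij.1 ij.2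

/-- Vectorization turns local operations into matrix products; the second factor enters through a
plain transpose. -/
theorem kronecker_mulVec_vecOf {m m' n n' : ℕ} (K : Matrix (Fin m') (Fin m) ℂ)
    (L : Matrix (Fin n') (Fin n) ℂ) (M : Matrix (Fin m) (Fin n) ℂ) :
    (K ⊗ₖ L) *ᵥ vecOf M = vecOf (K * M * Lᵀ) := by
  ext ⟨i, j⟩
  simp only [mulVec, dotProduct, vecOf, Matrix.mul_apply, kroneckerMap_apply, transpose_apply,
    Fintype.sum_prod_type, Finset.sum_mul]
  rw [Finset.sum_comm]
  refine Finset.sum_congr rfl fun l _ => Finset.sum_congr rfl fun k _ => by ring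

theorem ketbra_smul {ι : Type} (c : ℂ) (ψ : ι → ℂ) :
    ketbra (c • ψ) = (c * star c) • ketbra ψ := by
  ext i j
  simp only [ketbra, vecMulVec_apply, Pi.smul_apply, Pi.star_apply, smul_eq_mul,
    Matrix.smul_apply, star_mul']
  ring

theorem ketbra_posSemidef {ι : Type} [Fintype ι] (ψ : ι → ℂ) : (ketbra ψ).PosSemidef :=
  posSemidef_vecMulVec_self_star ψ

/-- The maximally entangled vector of `ℂ^d ⊗ ℂ^d`. -/
noncomputable def maxEntVec (d : ℕ) : Fin d × Fin d → ℂ :=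
  vecOf (((Real.sqrt d : ℝ) : ℂ)⁻¹ • (1 : Matrix (Fin d) (Fin d) ℂ))

theorem sqrt_inv_mul_star (d : ℕ) :
    ((Real.sqrt d : ℝ) : ℂ)⁻¹ * star ((Real.sqrt d : ℝ) : ℂ)⁻¹ = (d : ℂ)⁻¹ := by
  rw [star_inv₀, Complex.star_def, Complex.conj_ofReal, ← mul_inv, ← Complex.ofReal_mul,
    Real.mul_self_sqrt (Nat.cast_nonneg d), Complex.ofReal_natCast]

theorem trace_ketbra_vecOf {m n : ℕ} (M : Matrix (Fin m) (Fin n) ℂ) :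
    (ketbra (vecOf M)).trace = (Mᴴ * M).trace := by
  rw [ketbra, trace_vecMulVec]
  simp only [dotProduct, vecOf, Matrix.trace, Matrix.diag_apply,
    Matrix.mul_apply, conjTranspose_apply, Fintype.sum_prod_type, Pi.star_apply]
  rw [Finset.sum_comm]
  refine Finset.sum_congr rfl fun l _ => Finset.sum_congr rfl fun k _ => mul_comm _ _

theorem isState_maxEnt (n : ℕ) : IsState (ketbra (maxEntVec (n + 1))) := by
  refine ⟨ketbra_posSemidef _, ?_⟩
  rw [maxEntVec, trace_ketbra_vecOf, conjTranspose_smul, Matrix.smul_mul, Matrix.mul_smul,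
    smul_smul, mul_comm, sqrt_inv_mul_star]
  simp only [conjTranspose_one, mul_one, trace_smul, trace_one, Fintype.card_fin, smul_eq_mul]
  exact inv_mul_cancel₀ (Nat.cast_ne_zero.mpr n.succ_ne_zero)

/-- One-way protocols: a measurement on the first system and, depending on the outcome, an
isometry on the second one. -/
theorem isLOCC_oneWay {m n m' n' k : ℕ} (K : Fin k → Matrix (Fin m') (Fin m) ℂ)
    (hK : IsKraus (fun _ => m') K) (L : Fin k → Matrix (Fin n') (Fin n) ℂ)
    (hL : ∀ j, (L j)ᴴ * L j = 1) :
    IsLOCC (fun ρ : BiMat m n => ∑ j, actB (L j) (actA (K j) ρ)) := by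
  refine IsLOCC.stepA (fun _ => m') K hK (fun j ρ => actB (L j) ρ) fun j => ?_
  have h := IsLOCC.stepB (m := m') (n := n) (m' := m') (n' := n') (k := 1) (fun _ => n')
    (fun _ => L j) (by simp [IsKraus, hL]) (fun _ ρ => ρ) (fun _ => IsLOCC.refl m' n')
  simpa using h

/-- Every mixture of pure states of `ℂ^m ⊗ ℂ^d` can be obtained by LOCC from the maximally
entangled state of `ℂ^d ⊗ ℂ^d`. -/
theorem exists_isLOCC_maxEnt {m n N : ℕ} (M : Fin N → Matrix (Fin m) (Fin (n + 1)) ℂ)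
    (hM : ∑ l, ((M l)ᴴ * M l).trace = 1) :
    ∃ Λ : BiMat (n + 1) (n + 1) → BiMat m (n + 1), IsLOCC Λ ∧
      Λ (ketbra (maxEntVec (n + 1))) = ∑ l, ketbra (vecOf (M l)) := by
  -- `ZMod (n + 1)` unfolds to `Fin (n + 1)`, so the Weyl matrices can be read with `Fin` indices.
  -- Only unitarity and the twirl identity are kept.
  let W : ZMod (n + 1) → ZMod (n + 1) → Matrix (Fin (n + 1)) (Fin (n + 1)) ℂ :=
    fun a b => weyl a b
  have hW : ∀ a b, W a b * (W a b)ᴴ = 1 := weyl_mul_conjTranspose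
  have hsum : ∀ X : Matrix (Fin (n + 1)) (Fin (n + 1)) ℂ, ∑ a, ∑ b, (W a b)ᴴ * X * W a b =
      (((n + 1 : ℕ) : ℂ) * X.trace) • 1 := sum_weyl_conj
  clear_value W
  have hd : ((n + 1 : ℕ) : ℂ) ≠ 0 := Nat.cast_ne_zero.mpr n.succ_ne_zero
  set c : ℂ := ((Real.sqrt (n + 1 : ℕ) : ℝ) : ℂ)⁻¹ with hc
  have hcc : c * star c = ((n + 1 : ℕ) : ℂ)⁻¹ := sqrt_inv_mul_star (n + 1)
  let ι := Fin N × ZMod (n + 1) × ZMod (n + 1)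
  let e : Fin (Fintype.card ι) ≃ ι := (Fintype.equivFin ι).symm
  -- The correction satisfies `Lᵀ = Wᴴ`, so it undoes `W` after vectorization: outcome `(l, a, b)`
  -- leaves `c² M l`. Completeness of `K` is the twirl identity.
  let K : ι → Matrix (Fin m) (Fin (n + 1)) ℂ := fun x => c • (M x.1 * W x.2.1 x.2.2)
  let L : ι → Matrix (Fin (n + 1)) (Fin (n + 1)) ℂ := fun x => ((W x.2.1 x.2.2)ᴴ)ᵀ
  have hL : ∀ x, (L x)ᴴ * L x = 1 := by
    intro x
    have h := congrArg transpose (hW x.2.1 x.2.2)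
    rw [transpose_mul, transpose_one] at h
    rw [← h]
    have : (L x)ᴴ = (W x.2.1 x.2.2)ᵀ := by
      ext i j; simp [L]
    rw [this, h]
    exact mul_eq_one_comm.mp h
  have hK : ∑ x, (K x)ᴴ * K x = 1 := by
    have hx : ∀ x, (K x)ᴴ * K x =
        ((n + 1 : ℕ) : ℂ)⁻¹ • ((W x.2.1 x.2.2)ᴴ * ((M x.1)ᴴ * M x.1) * W x.2.1 x.2.2) := by
      intro x
      simp only [K, conjTranspose_smul, conjTranspose_mul, Matrix.smul_mul, Matrix.mul_smul,
        smul_smul, hcc, Matrix.mul_assoc]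
    simp only [hx, ← Finset.smul_sum, ι, Fintype.sum_prod_type, hsum]
    rw [← Finset.sum_smul, ← Finset.mul_sum, hM, mul_one, smul_smul, inv_mul_cancel₀ hd, one_smul]
  refine ⟨_, isLOCC_oneWay (fun j => K (e j)) ?_ (fun j => L (e j)) (fun j => hL _), ?_⟩
  · rw [IsKraus, ← hK]
    exact Equiv.sum_comp e (fun x => (K x)ᴴ * K x)
  · have hx : ∀ x, actB (L x) (actA (K x) (ketbra (maxEntVec (n + 1)))) =
        (((n + 1 : ℕ) : ℂ)⁻¹ * ((n + 1 : ℕ) : ℂ)⁻¹) • ketbra (vecOf (M x.1)) := by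
      intro x
      have hv : vecOf ((c * c) • M x.1) = (c * c) • vecOf (M x.1) := rfl
      rw [actA_ketbra, actB_ketbra, maxEntVec, kronecker_mulVec_vecOf, kronecker_mulVec_vecOf]
      simp only [K, L, ← hc, transpose_transpose, transpose_one, Matrix.smul_mul,
        Matrix.mul_smul, Matrix.mul_one, Matrix.one_mul, Matrix.mul_assoc, hW, smul_smul]
      rw [hv, ketbra_smul, star_mul', mul_mul_mul_comm, hcc]
    calc _ = ∑ x, actB (L x) (actA (K x) (ketbra (maxEntVec (n + 1)))) :=
          Equiv.sum_comp e (fun x => actB (L x) (actA (K x) (ketbra (maxEntVec (n + 1)))))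
      _ = _ := by
        -- The `(n + 1)²` pairs `(a, b)` give the same state, each with weight `(n + 1)⁻²`.
        simp only [hx, ι, Fintype.sum_prod_type, Finset.sum_const, Finset.card_univ, Fintype.card_prod, ZMod.card,
          ← Nat.cast_smul_eq_nsmul ℂ, smul_smul]
        refine Finset.sum_congr rfl fun l _ => ?_
        rw [show (((n + 1) * (n + 1) : ℕ) : ℂ) *
          (((n + 1 : ℕ) : ℂ)⁻¹ * ((n + 1 : ℕ) : ℂ)⁻¹) = 1 by
            rw [Nat.cast_mul (n + 1) (n + 1)]; field_simp, one_smul]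

/-! ### States with a given spectrum -/

theorem trace_ketbra_basis {d₁ d₂ : ℕ}
    (b : OrthonormalBasis (Fin (d₁ * d₂)) ℂ (EuclideanSpace ℂ (Fin d₁ × Fin d₂)))
    (i : Fin (d₁ * d₂)) : (ketbra (b i).ofLp).trace = 1 := by
  have h := b.inner_eq_one i
  rw [EuclideanSpace.inner_eq_star_dotProduct] at h
  rw [ketbra, trace_vecMulVec, h]

theorem isState_spectralState {d₁ d₂ : ℕ} {p : Fin (d₁ * d₂) → ℝ} (hp : p ∈ probVecs (d₁ * d₂))
    (b : OrthonormalBasis (Fin (d₁ * d₂)) ℂ (EuclideanSpace ℂ (Fin d₁ × Fin d₂))) :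
    IsState (spectralState p b) := by
  refine ⟨posSemidef_sum _ fun i _ => (ketbra_posSemidef _).smul ?_, ?_⟩
  · exact_mod_cast hp.2.1 i
  · simp only [spectralState, trace_sum, trace_smul, trace_ketbra_basis, smul_eq_mul, mul_one]
    exact_mod_cast hp.2.2

/-- The bound is uniform in `p` and in the basis. The weights are absorbed into the coefficient
matrices as `√(p l)`. -/
theorem IsEntanglementMonotone.spectralState_le {E : BiFun} (hE : IsEntanglementMonotone E)
    {d₁ n : ℕ} {p : Fin (d₁ * (n + 1)) → ℝ} (hp : p ∈ probVecs (d₁ * (n + 1)))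
    (b : OrthonormalBasis (Fin (d₁ * (n + 1))) ℂ (EuclideanSpace ℂ (Fin d₁ × Fin (n + 1)))) :
    E d₁ (n + 1) (spectralState p b) ≤
      E (n + 1) (n + 1) (ketbra (maxEntVec (n + 1))) := by
  let M : Fin (d₁ * (n + 1)) → Matrix (Fin d₁) (Fin (n + 1)) ℂ :=
    fun l i j => ((Real.sqrt (p l) : ℝ) : ℂ) * (b l).ofLp (i, j)
  have hM : ∀ l, ketbra (vecOf (M l)) = ((p l : ℝ) : ℂ) • ketbra (b l).ofLp := by
    intro l
    have : vecOf (M l) = ((Real.sqrt (p l) : ℝ) : ℂ) • (b l).ofLp := rfl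
    rw [this, ketbra_smul, Complex.star_def, Complex.conj_ofReal, ← Complex.ofReal_mul,
      Real.mul_self_sqrt (hp.2.1 l)]
  obtain ⟨Λ, hΛ, h⟩ := exists_isLOCC_maxEnt M (by
    simp only [← trace_ketbra_vecOf, hM, trace_smul, trace_ketbra_basis, smul_eq_mul, mul_one]
    exact_mod_cast hp.2.2)
  have := hE.locc _ _ _ _ Λ hΛ _ (isState_maxEnt n)
  rw [h] at this
  simpa only [hM, spectralState] using this

/-! ### The range of the correlation function -/

theorem convex_probVecs (d : ℕ) : Convex ℝ (probVecs d) := by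
  rintro p ⟨hp, hp0, hp1⟩ q ⟨hq, hq0, hq1⟩ s t hs ht hst
  refine ⟨fun i j hij => ?_, fun i => ?_, ?_⟩
  · simp only [Pi.add_apply, Pi.smul_apply, smul_eq_mul]
    gcongr
    exacts [hp hij, hq hij]
  · have := hp0 i
    have := hq0 i
    simp only [Pi.add_apply, Pi.smul_apply, smul_eq_mul]
    positivity
  · simp only [Pi.add_apply, Pi.smul_apply, smul_eq_mul, Finset.sum_add_distrib,
      ← Finset.mul_sum, hp1, hq1, mul_one, hst]

theorem isCompact_probVecs (d : ℕ) : IsCompact (probVecs d) := by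
  have h : probVecs d = {p : Fin d → ℝ | Antitone p} ∩ stdSimplex ℝ (Fin d) := rfl
  rw [h]
  exact (isCompact_stdSimplex ℝ (Fin d)).inter_left isClosed_antitone

theorem single_zero_mem_probVecs (n : ℕ) : (Pi.single 0 1 : Fin (n + 1) → ℝ) ∈ probVecs (n + 1) := by
  refine ⟨fun i j hij => ?_, fun i => ?_, by simp⟩
  · by_cases hj : j = 0
    · subst hj
      rw [Fin.le_zero_iff.mp hij]
    · rw [Pi.single_eq_of_ne hj]
      by_cases hi : i = 0 <;> simp [hi]
  · by_cases hi : i = 0 <;> simp [hi]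

/-- The Schmidt vector is here `|0⟩|0⟩`, a product state. -/
theorem IsCorrelationMonotone.corrFun_single_zero {C : BiFun} (hC : IsCorrelationMonotone C)
    (n : ℕ) : corrFun C (Pi.single 0 1 : Fin (n + 1) → ℝ) = 0 := by
  let e : Fin (n + 1) → ℂ := Pi.single 0 1
  have he : IsState (ketbra e) := by
    refine ⟨ketbra_posSemidef _, ?_⟩
    rw [ketbra, trace_vecMulVec]
    simp [e]
  refine hC.product _ _ _ ⟨ketbra e, ketbra e, he, he, ?_⟩
  have hs : schmidtVec (Pi.single 0 1 : Fin (n + 1) → ℝ) = fun ij => e ij.1 * e ij.2 := by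
    ext ⟨i, j⟩
    by_cases hi : i = 0 <;> by_cases hj : j = 0 <;> by_cases hij : i = j <;>
      simp_all [schmidtVec, e]
  ext ⟨i, j⟩ ⟨k, l⟩
  simp only [hs, ketbra, vecMulVec_apply, kroneckerMap_apply, Pi.star_apply, star_mul']
  ring

/-- Every value in `[0, c_d]` is attained by `f`. -/
theorem IsCorrelationMonotone.exists_corrFun_eq {C : BiFun} (hC : IsCorrelationMonotone C)
    {d : ℕ} (hd : d ≠ 0)
    (hf : ContinuousOn (fun p : Fin d → ℝ => corrFun C p) (probVecs d))
    {x : ℝ} (hx : x ∈ Set.Icc 0 (corrMax C d)) : ∃ p ∈ probVecs d, corrFun C p = x := by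
  obtain ⟨n, rfl⟩ := Nat.exists_eq_succ_of_ne_zero hd
  have h0 := single_zero_mem_probVecs n
  obtain ⟨q, hq, hqc⟩ := (isCompact_probVecs _).exists_sSup_image_eq ⟨_, h0⟩ hf
  have h := (convex_probVecs (n + 1)).isPreconnected.intermediate_value h0 hq hf
  simp only [hC.corrFun_single_zero] at h
  exact h ⟨hx.1, hx.2.trans_eq hqc⟩

/-! ### The zeros of `ξ` -/

section Zeros

variable {E C : BiFun} {d₁ d₂ : ℕ}

theorem bddAbove_spectralState (hE : IsEntanglementMonotone E) (hd₂ : d₂ ≠ 0) :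
    ∃ B, 0 ≤ B ∧ ∀ p ∈ probVecs (d₁ * d₂), ∀ b, E d₁ d₂ (spectralState p b) ≤ B := by
  obtain ⟨n, rfl⟩ := Nat.exists_eq_succ_of_ne_zero hd₂
  exact ⟨_, hE.nonneg _ _ _ (isState_maxEnt n), fun p hp b => hE.spectralState_le hp b⟩

theorem entEntropy_le (hE : IsEntanglementMonotone E) {p : Fin (d₁ * d₂) → ℝ}
    (hp : p ∈ probVecs (d₁ * d₂)) : entEntropy E d₁ d₂ p ≤ entMax E d₁ d₂ := by
  refine sub_le_self _ (Real.sSup_nonneg ?_)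
  rintro y ⟨b, rfl⟩
  exact hE.nonneg _ _ _ (isState_spectralState hp b)

theorem bddBelow_entEntropy (hE : IsEntanglementMonotone E) (hd₂ : d₂ ≠ 0) (x : ℝ) :
    BddBelow {y | ∃ p ∈ probVecs (d₁ * d₂), corrFun C p = x ∧ y = entEntropy E d₁ d₂ p} := by
  obtain ⟨B, hB, h⟩ := bddAbove_spectralState (d₁ := d₁) hE hd₂
  refine ⟨entMax E d₁ d₂ - B, ?_⟩
  rintro y ⟨p, hp, -, rfl⟩
  refine sub_le_sub_left (Real.sSup_le ?_ hB) _
  rintro y ⟨b, rfl⟩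
  exact h p hp b

theorem xi_nonneg (hE : IsEntanglementMonotone E) (hd₂ : d₂ ≠ 0) {x : ℝ}
    (hx : ∃ p ∈ probVecs (d₁ * d₂), corrFun C p = x) : 0 ≤ xi E C d₁ d₂ x := by
  obtain ⟨p, hp, hpx⟩ := hx
  exact sub_nonneg.mpr ((csInf_le (bddBelow_entEntropy hE hd₂ x) ⟨p, hp, hpx, rfl⟩).trans
    (entEntropy_le hE hp))

/-- `ξ(x) = 0` if and only if all states whose spectrum `p` satisfies `f(p) = x` are separable. -/
theorem xi_eq_zero_iff (hE : IsEntanglementMonotone E) (hE0 : ZeroOnlyForSeparable E)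
    (hd₂ : d₂ ≠ 0) {x : ℝ} (hx : ∃ p ∈ probVecs (d₁ * d₂), corrFun C p = x) :
    xi E C d₁ d₂ x = 0 ↔ ∀ p ∈ probVecs (d₁ * d₂), corrFun C p = x →
      ∀ b, IsSeparable (spectralState (d₁ := d₁) (d₂ := d₂) p b) := by
  constructor
  · intro h p hp hpx b
    refine hE0 _ _ _ (isState_spectralState hp b)
      (le_antisymm ?_ (hE.nonneg _ _ _ (isState_spectralState hp b)))
    have h1 : gFun E C d₁ d₂ x ≤ entEntropy E d₁ d₂ p :=
      csInf_le (bddBelow_entEntropy hE hd₂ x) ⟨p, hp, hpx, rfl⟩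
    obtain ⟨B, -, hB⟩ := bddAbove_spectralState (d₁ := d₁) hE hd₂
    have h2 : E d₁ d₂ (spectralState p b) ≤ sSup {y | ∃ b, y = E d₁ d₂ (spectralState p b)} := by
      refine le_csSup ⟨B, ?_⟩ ⟨b, rfl⟩
      rintro y ⟨b, rfl⟩
      exact hB p hp b
    rw [xi] at h
    rw [entEntropy] at h1
    linarith
  · intro h
    have hs : {y | ∃ p ∈ probVecs (d₁ * d₂), corrFun C p = x ∧ y = entEntropy E d₁ d₂ p} =
        {entMax E d₁ d₂} := by
      have he : ∀ p ∈ probVecs (d₁ * d₂), corrFun C p = x →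
          entEntropy E d₁ d₂ p = entMax E d₁ d₂ := by
        intro p hp hpx
        refine le_antisymm (entEntropy_le hE hp) (le_sub_self_iff _ |>.mpr (Real.sSup_nonpos ?_))
        rintro y ⟨b, rfl⟩
        exact (hE.separable _ _ _ (h p hp hpx b)).le
      ext y
      constructor
      · rintro ⟨p, hp, hpx, rfl⟩
        exact he p hp hpx
      · rintro rfl
        obtain ⟨p, hp, hpx⟩ := hx
        exact ⟨p, hp, hpx, (he p hp hpx).symm⟩
    rw [xi, gFun, hs, csInf_singleton, sub_self]

end Zeros

end QInfo

theorem mainTheorem6 (E E' C : BiFun)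
    (hE : IsEntanglementMonotone E) (hE' : IsEntanglementMonotone E')
    (hE0 : ZeroOnlyForSeparable E) (hE0' : ZeroOnlyForSeparable E')
    (hC : IsCorrelationMonotone C)
    (d₁ d₂ : ℕ) (hd₁ : 2 ≤ d₁) (hd₂ : d₁ ≤ d₂)
    (hf : ContinuousOn (fun p : Fin (d₁ * d₂) → ℝ => corrFun C p) (probVecs (d₁ * d₂))) :
    (∀ J : Set ℝ, J.OrdConnected → J ⊆ Set.Icc 0 (corrMax C (d₁ * d₂)) →
      VanishesExactlyOn (xi E C d₁ d₂) (corrMax C (d₁ * d₂)) J →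
        VanishesExactlyOn (xi E' C d₁ d₂) (corrMax C (d₁ * d₂)) J) ∧
    {x | x ∈ Set.Icc 0 (corrMax C (d₁ * d₂)) ∧ xi E C d₁ d₂ x = 0} =
      {x | x ∈ Set.Icc 0 (corrMax C (d₁ * d₂)) ∧ xi E' C d₁ d₂ x = 0} ∧
    (∀ t : ℝ, IsThreshold (xi E C d₁ d₂) (corrMax C (d₁ * d₂)) t ↔
      IsThreshold (xi E' C d₁ d₂) (corrMax C (d₁ * d₂)) t) := by
  have hd : d₁ * d₂ ≠ 0 := Nat.mul_ne_zero (by omega) (by omega)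
  have hd₂' : d₂ ≠ 0 := by omega
  have hfib : ∀ x ∈ Set.Icc 0 (corrMax C (d₁ * d₂)), ∃ p ∈ probVecs (d₁ * d₂), corrFun C p = x :=
    fun x hx => hC.exists_corrFun_eq hd hf hx
  have hzero : ∀ x ∈ Set.Icc 0 (corrMax C (d₁ * d₂)),
      (xi E C d₁ d₂ x = 0 ↔ xi E' C d₁ d₂ x = 0) := fun x hx =>
    (xi_eq_zero_iff hE hE0 hd₂' (hfib x hx)).trans (xi_eq_zero_iff hE' hE0' hd₂' (hfib x hx)).symm
  have hpos : ∀ x ∈ Set.Icc 0 (corrMax C (d₁ * d₂)),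
      (0 < xi E C d₁ d₂ x ↔ 0 < xi E' C d₁ d₂ x) := fun x hx => by
    rw [(xi_nonneg hE hd₂' (hfib x hx)).lt_iff_ne', (xi_nonneg hE' hd₂' (hfib x hx)).lt_iff_ne']
    exact not_congr (hzero x hx)
  refine ⟨fun J _ hJ h => ⟨fun x hx => (hzero x (hJ hx)).mp (h.1 x hx),
    fun x hx => (hpos x hx.1).mp (h.2 x hx)⟩, ?_, fun t => ?_⟩
  · ext x
    exact and_congr_right (hzero x)
  · refine and_congr_right fun ht0 => and_congr_right fun htc => and_congr ?_ ?_
    · exact forall_congr' fun x => forall_congr' fun htx => forall_congr' fun hxc =>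
        hzero x ⟨ht0.trans htx.le, hxc⟩
    · exact forall_congr' fun x => forall_congr' fun hx0 => forall_congr' fun hxt =>
        hpos x ⟨hx0, (hxt.trans htc).le⟩
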